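/- Let $U$ be a non-empty set and let $X=(X_u)_{u\in U}$ be a real-valued stochastic field on a probability space which is infinitely divisible: for every integer $n\ge 1$ there are $n$ independent and identically distributed fields $X^{1,n},\dots,X^{n,n}$ indexed by $U$ such that $X$ has the same law on $\mathbb{R}^U$ as $X^{1,n}+\cdots+X^{n,n}$. Here $\mathbb{R}^U$ carries the cylindrical (product) $\sigma$-algebra $\mathcal{B}(\mathbb{R})^U$. For a finite set $\widehat u\subset U$ let $\pi_{\widehat u}:\mathbb{R}^U\to\mathbb{R}^{\widehat u}$ be the projection, let $0^{\widehat u}$ be the origin of $\mathbb{R}^{\widehat u}$, and let $(\gamma_{\widehat u},B_{\widehat u},\nu_{\widehat u})$ be the characteristic triplet of the law of $X_{\widehat u}=(X_u)_{u\in\widehat u}$. That is, $\gamma_{\widehat u}\in\mathbb{R}^{\widehat u}$, $B_{\widehat u}$ is a symmetric non-negative definite real $\widehat u\times\widehat u$ matrix, $\nu_{\widehat u}$ is a Borel measure on $\mathbb{R}^{\widehat u}$ with $\nu_{\widehat u}(\{0^{\widehat u}\})=0$ and $\int 1\wedge|x|^2\,\nu_{\widehat u}(dx)<\infty$, and $$\mathbb{E}\,e^{i\langle\theta,X_{\widehat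 u}\rangle}=\exp\Big(i\langle\theta,\gamma_{\widehat u}\rangle-\tfrac12\langle\theta,B_{\widehat u}\theta\rangle+\int_{\mathbb{R}^{\widehat u}}\big[e^{i\langle\theta,x\rangle}-1-i\langle\theta,\tau(x)\rangle\big]\nu_{\widehat u}(dx)\Big),\qquad \theta\in\mathbb{R}^{\widehat u},$$ where $\tau(x)=\big(x_u/(1\vee|x_u|)\big)_{u\in\widehat u}$. Say that a measure $\nu$ on $\mathcal{B}(\mathbb{R})^U$ does not charge zero if there is a countable set $U_0\subset U$ with $\nu(\{x\in\mathbb{R}^U: x_u=0\text{ for all }u\in U_0\})=0$. Then the following hold. 1. There are a unique function $\Gamma:U\to\mathbb{R}$ and a unique function $B:U\times U\to\mathbb{R}$ such that $\gamma_{\widehat u}=\pi_{\widehat u}(\Gamma)$ and $B_{\widehat u}=(B(u,v))_{u,v\in\widehat u}$ for every finite $\widehat u\subset U$. 2. There is a measure $\nu$ on $(\mathbb{R}^U,\mathcal{B}(\mathbb{R})^U)$ such that $$\nu_{\widehat u}(A)=\nu(\pi_{\widehat u}^{-1}(A))\quad\text{for all finite }\widehat u\subset U\text{ and all Borel sets }A\subset\mathbb{R}^{\widehat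 u}\setminus\{0^{\widehat u}\},\tag{$*$}$$ and $\int_{\mathbb{R}^U}1\wedge|x_u|^2\,\nu(dx)<\infty$ for every $u\in U$. 3. If a measure $\nu$ on $\mathcal{B}(\mathbb{R})^U$ satisfies $(*)$ and does not charge zero, then it is the only measure on $\mathcal{B}(\mathbb{R})^U$ that satisfies $(*)$ and does not charge zero. -/

import Mathlib

open MeasureTheory ProbabilityTheory
open scoped Matrix

namespace IDField

/-- A real-valued stochastic field `X = (X_u)_{u ∈ U}` on `(Ω, P)` is infinitely divisible if for
every `n ≥ 1` it has the law, on the product `σ`-algebra of `ℝ^U`, of a sum of `n` independent and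
identically distributed fields. The auxiliary probability space may be taken in the universe of
`U`, since `(ℝ^U)^n` with a product measure always serves as such a space. -/
def IsInfinitelyDivisible.{u, v} {U : Type u} {Ω : Type v} [MeasurableSpace Ω]
    (X : U → Ω → ℝ) (P : Measure Ω) : Prop :=
  ∀ n : ℕ, 1 ≤ n →
    ∃ (Ω' : Type u) (_ : MeasurableSpace Ω') (P' : Measure Ω') (Y : Fin n → Ω' → U → ℝ),
      IsProbabilityMeasure P' ∧
      (∀ i, Measurable (Y i)) ∧
      iIndepFun Y P' ∧
      (∀ i j, IdentDistrib (Y i) (Y j) P' P') ∧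
      IdentDistrib (fun ω u => X u ω) (fun ω => ∑ i, Y i ω) P P'

/-- A Lévy measure on `ℝ^ι`: no mass at the origin, and `∫ 1 ∧ |x|² ν(dx) < ∞` with the
Euclidean norm. -/
def IsLevyMeasure {ι : Type*} [Fintype ι] (ν : Measure (EuclideanSpace ℝ ι)) : Prop :=
  ν {0} = 0 ∧ ∫⁻ x, ENNReal.ofReal (min 1 (‖x‖ ^ 2)) ∂ν < ⊤

/-- The truncation function `τ(x) = (x_i / (1 ∨ |x_i|))_i`. -/
noncomputable def trunc {ι : Type*} (x : EuclideanSpace ℝ ι) : EuclideanSpace ℝ ι :=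
  WithLp.toLp 2 fun i => x i / max 1 |x i|

/-- The Lévy–Khintchine exponent
`i⟨θ, γ⟩ - ½⟨θ, Bθ⟩ + ∫ (e^{i⟨θ, x⟩} - 1 - i⟨θ, τ(x)⟩) ν(dx)`. -/
noncomputable def levyExponent {ι : Type*} [Fintype ι] (γ : EuclideanSpace ℝ ι)
    (B : Matrix ι ι ℝ) (ν : Measure (EuclideanSpace ℝ ι)) (θ : EuclideanSpace ℝ ι) : ℂ :=
  Complex.I * (inner ℝ θ γ : ℝ)
    - (1 / 2 : ℂ) * ((θ.ofLp ⬝ᵥ B *ᵥ θ.ofLp : ℝ) : ℂ)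
    + ∫ x, (Complex.exp (Complex.I * (inner ℝ θ x : ℝ)) - 1
        - Complex.I * (inner ℝ θ (trunc x) : ℝ)) ∂ν

/-- `(γ, B, ν)` is the characteristic triplet of the law `μ` on `ℝ^ι`. -/
structure IsCharTriplet {ι : Type*} [Fintype ι] (μ : Measure (EuclideanSpace ℝ ι))
    (γ : EuclideanSpace ℝ ι) (B : Matrix ι ι ℝ) (ν : Measure (EuclideanSpace ℝ ι)) : Prop where
  posSemidef : B.PosSemidef
  isLevyMeasure : IsLevyMeasure ν
  charFun_eq : ∀ θ, charFun μ θ = Complex.exp (levyExponent γ B ν θ)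

/-- The projection `π_û : ℝ^U → ℝ^û`, for a finite subset `û` of `U`. -/
def proj {U : Type*} (s : Finset U) (x : U → ℝ) : EuclideanSpace ℝ s :=
  WithLp.toLp 2 (s.restrict x)

/-- `(γ_û, B_û, ν_û)_û` is the system of characteristic triplets of the field `X`: for every finite
`û ⊆ U` the law of `(X_u)_{u ∈ û}` has characteristic triplet `(γ_û, B_û, ν_û)`. -/
def IsTripletSystem {U Ω : Type*} [MeasurableSpace Ω] (X : U → Ω → ℝ) (P : Measure Ω)
    (γ : ∀ s : Finset U, EuclideanSpace ℝ s) (B : ∀ s : Finset U, Matrix s s ℝ)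
    (ν : ∀ s : Finset U, Measure (EuclideanSpace ℝ s)) : Prop :=
  ∀ s : Finset U, IsCharTriplet (P.map fun ω => proj s fun u => X u ω) (γ s) (B s) (ν s)

/-- The measure `ν` on the cylindrical `σ`-algebra of `ℝ^U` projects onto the measures `ν_û` away
from the origin: `ν_û(A) = ν(π_û⁻¹(A))` for all Borel sets `A ⊆ ℝ^û \ {0}`. -/
def ProjectsOnto {U : Type*} (ν : Measure (U → ℝ))
    (νfd : ∀ s : Finset U, Measure (EuclideanSpace ℝ s)) : Prop :=
  ∀ (s : Finset U) (A : Set (EuclideanSpace ℝ s)), MeasurableSet A → 0 ∉ A →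
    νfd s A = ν (proj s ⁻¹' A)

/-- `ν` does not charge zero: for some countable `U₀ ⊆ U`, the set of those `x` that vanish on all
of `U₀` is a null set. -/
def DoesNotChargeZero {U : Type*} (ν : Measure (U → ℝ)) : Prop :=
  ∃ U₀ : Set U, U₀.Countable ∧ ν {x | ∀ u ∈ U₀, x u = 0} = 0

end IDField

/-! Everything rests on consistency of the triplets. A triplet on ℝ^ι is unique
(`IsCharTriplet.unique`): continuity and the value 0 at the origin fix the logarithm of the
characteristic function, and a second difference of that exponent in direction h is the
characteristic function of the finite measure (1 - cos⟨h, x⟩) ν(dx) + ½⟨h, Bh⟩ δ₀. Its atom gives B,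
the rest gives ν, and then γ is left. A marginal law has the projected drift, the submatrix, and the
image of ν stripped of its mass at 0. So the drift is read off singletons and the covariance off
pairs.

The Lévy measures fail to be projective only at the origins. An atom of infinite mass at each origin
repairs this, and a Kolmogorov extension for infinite measures applies (`exists_isProjectiveLimit`):
a cylinder through the zero path has infinite content, and any other one is σ-finite, hence
approximable by cylinders of finite content, where compactness gives countable subadditivity.

For uniqueness, the projections fix ν on each set {|x_u| > 1/(n+1)}, where it is finite. If two
measures do not charge zero, countably many such sets carry both. -/

section

open Filter Set Topology
open scoped ENNReal

/-! ### Kolmogorov extension for infinite measures -/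

section ProjectiveExtension

/-- Cylinders over closed compact sets form a compact system. -/
lemma isCompactSystem_closedCompactCylinders {ι : Type*} (X : ι → Type*)
    [∀ i, TopologicalSpace (X i)] : IsCompactSystem (closedCompactCylinders X) := by
  refine IsCompactSystem.of_nonempty_iInter fun C hC hne ↦ ?_
  choose I K hK_closed hK hCK using fun n ↦ (mem_closedCompactCylinders _).1 (hC n)
  choose x hx using hne
  -- A nonprincipal ultrafilter replaces a diagonal extraction: every coordinate constrained by some
  -- `C n` converges along it, and the others are filled arbitrarily.
  let F : Ultrafilter ℕ := hyperfilter ℕ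
  have hF : (F : Filter ℕ) ≤ atTop := Nat.hyperfilter_le_atTop
  have hev : ∀ n, ∀ᶠ k in (F : Filter ℕ), (I n).restrict (x k) ∈ K n := fun n ↦ by
    filter_upwards [hF (eventually_ge_atTop n)] with k hk
    have := mem_dissipate.1 (hx k) n hk
    rwa [hCK n] at this
  have hlim : ∀ n, ∃ y, Tendsto (fun k ↦ (I n).restrict (x k)) F (𝓝 y) := fun n ↦ by
    obtain ⟨y, -, hy⟩ := isCompact_iff_ultrafilter_le_nhds.1 (hK n)
      (F.map fun k ↦ (I n).restrict (x k)) (le_principal_iff.2 (hev n))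
    exact ⟨y, hy⟩
  have hcoord : ∀ i, ∃ z, (∃ n, i ∈ I n) → Tendsto (fun k ↦ x k i) F (𝓝 z) := fun i ↦ by
    by_cases hi : ∃ n, i ∈ I n
    · obtain ⟨n, hn⟩ := hi
      obtain ⟨y, hy⟩ := hlim n
      exact ⟨y ⟨i, hn⟩, fun _ ↦ tendsto_pi_nhds.1 hy ⟨i, hn⟩⟩
    · exact ⟨x 0 i, fun h ↦ absurd h hi⟩
  choose z hz using hcoord
  refine ⟨z, mem_iInter.2 fun n ↦ ?_⟩
  rw [hCK n]
  exact (hK_closed n).mem_of_tendsto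
    (tendsto_pi_nhds.2 fun i ↦ hz i ⟨n, i.2⟩) (hev n)

variable {ι : Type*} {X : ι → Type*} [∀ i, TopologicalSpace (X i)] [∀ i, MeasurableSpace (X i)]
  [∀ i, PolishSpace (X i)] [∀ i, BorelSpace (X i)]
  {P : ∀ J : Finset ι, Measure (∀ j : J, X j)}

/-- The content of a projective family of measures is inner regular with respect to the cylinders
over compact sets, on cylinders of finite content. -/
lemma exists_closedCompactCylinder_subset (hP : IsProjectiveMeasureFamily P) {s : Set (∀ i, X i)}
    (hs : s ∈ measurableCylinders X) (hfin : projectiveFamilyContent hP s ≠ ∞) {δ : ℝ≥0∞}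
    (hδ : 0 < δ) :
    ∃ C ∈ closedCompactCylinders X, C ⊆ s ∧ projectiveFamilyContent hP (s \ C) ≤ δ := by
  obtain ⟨I, S, hS, rfl⟩ := (mem_measurableCylinders _).1 hs
  rw [projectiveFamilyContent_cylinder hP hS] at hfin
  -- Inner regularity needs a level strictly below `P I S`; `P I S - δ` is one only when `P I S` is
  -- nonzero.
  by_cases h0 : P I S = 0
  · exact ⟨∅, empty_mem_closedCompactCylinders X, empty_subset _, by
      rw [sdiff_empty, projectiveFamilyContent_cylinder hP hS, h0]; exact zero_le⟩
  have : IsFiniteMeasure ((P I).restrict S) := ⟨by simpa using hfin.lt_top⟩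
  obtain ⟨K, hKS, ⟨hKc, hKcl⟩, hlt⟩ :=
    innerRegular_isCompact_isClosed_measurableSet_of_finite ((P I).restrict S) hS (P I S - δ)
      (by rw [Measure.restrict_apply_self]; exact ENNReal.sub_lt_self hfin h0 hδ.ne')
  rw [Measure.restrict_eq_self _ hKS] at hlt
  refine ⟨cylinder I K, cylinder_mem_closedCompactCylinders I K hKcl hKc,
    preimage_mono hKS, ?_⟩
  rw [sdiff_cylinder_same, projectiveFamilyContent_cylinder hP (hS.diff hKcl.measurableSet),
    measure_sdiff hKS hKcl.measurableSet.nullMeasurableSet (measure_ne_top_of_subset hKS hfin)]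
  rw [tsub_le_iff_left, ← tsub_le_iff_right]
  exact hlt.le

/-- The content of a projective family of measures is continuous at `∅` along sequences of
cylinders of finite content. -/
lemma tendsto_projectiveFamilyContent_zero (hP : IsProjectiveMeasureFamily P)
    {s : ℕ → Set (∀ i, X i)} (hs : ∀ n, s n ∈ measurableCylinders X) (hanti : Antitone s)
    (hempty : ⋂ n, s n = ∅) (hfin : projectiveFamilyContent hP (s 0) ≠ ∞) :
    Tendsto (fun n ↦ projectiveFamilyContent hP (s n)) atTop (𝓝 0) := by
  rw [ENNReal.tendsto_atTop_zero]
  intro ε hε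
  obtain ⟨δ, hδ, hsum⟩ := ENNReal.exists_pos_sum_of_countable' hε.ne' ℕ
  have hfin' : ∀ n, projectiveFamilyContent hP (s n) ≠ ∞ := fun n ↦
    ne_top_of_le_ne_top hfin
      (projectiveFamilyContent_mono hP (hs n) (hs 0) (hanti (Nat.zero_le n)))
  choose C hC hCs hCδ using fun n ↦
    exists_closedCompactCylinder_subset hP (hs n) (hfin' n) (hδ n)
  obtain ⟨N, hN⟩ := isCompactSystem_closedCompactCylinders X C hC
    (subset_empty_iff.1 (hempty ▸ iInter_mono hCs))
  have hmem : ∀ n, s n \ C n ∈ measurableCylinders X := fun n ↦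
    sdiff_mem_measurableCylinders (hs n) (mem_measurableCylinders_of_mem_closedCompactCylinders (hC n))
  refine ⟨N, fun n hn ↦ ?_⟩
  -- A point of `s n` lies in every earlier `s i`, yet misses some `C i` with `i ≤ N`; the summable
  -- errors then bound the content.
  have hsub : s n ⊆ ⋃ i ≤ N, s i \ C i := by
    intro x hx
    have hxC : x ∉ dissipate C N := by simp [hN]
    rw [mem_dissipate] at hxC
    push Not at hxC
    obtain ⟨i, hi, hxi⟩ := hxC
    exact mem_iUnion₂.2 ⟨i, hi, hanti (hi.trans hn) hx, hxi⟩
  have hU : (⋃ i ≤ N, s i \ C i) ∈ measurableCylinders X := by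
    simpa [Nat.lt_succ_iff] using
      isSetRing_measurableCylinders.biUnion_mem (Finset.range (N + 1)) fun i _ ↦ hmem i
  calc projectiveFamilyContent hP (s n)
      ≤ projectiveFamilyContent hP (⋃ i ≤ N, s i \ C i) :=
        projectiveFamilyContent_mono hP (hs n) hU hsub
    _ ≤ ∑ i ∈ Finset.range (N + 1), projectiveFamilyContent hP (s i \ C i) :=
        projectiveFamilyContent_iUnion_le hP hmem N
    _ ≤ ∑ i ∈ Finset.range (N + 1), δ i := Finset.sum_le_sum fun i _ ↦ hCδ i
    _ ≤ ∑' i, δ i := ENNReal.sum_le_tsum _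
    _ ≤ ε := hsum.le

/-- Countable subadditivity, on cylinders of finite content, of the content of a projective
family. -/
lemma projectiveFamilyContent_le_tsum (hP : IsProjectiveMeasureFamily P)
    {B : Set (∀ i, X i)} (hB : B ∈ measurableCylinders X)
    (hfin : projectiveFamilyContent hP B ≠ ∞) {f : ℕ → Set (∀ i, X i)}
    (hf : ∀ n, f n ∈ measurableCylinders X) (hsub : B ⊆ ⋃ n, f n) :
    projectiveFamilyContent hP B ≤ ∑' n, projectiveFamilyContent hP (f n) := by
  have hU : ∀ n, (⋃ i ∈ Finset.range n, f i) ∈ measurableCylinders X := fun n ↦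
    isSetRing_measurableCylinders.biUnion_mem _ fun i _ ↦ hf i
  let s : ℕ → Set (∀ i, X i) := fun n ↦ B \ ⋃ i ∈ Finset.range n, f i
  have hs : ∀ n, s n ∈ measurableCylinders X := fun n ↦ sdiff_mem_measurableCylinders hB (hU n)
  have hanti : Antitone s := fun m n hmn ↦ sdiff_subset_sdiff_right
    (biUnion_subset_biUnion_left fun i hi ↦
      Finset.mem_range.2 ((Finset.mem_range.1 hi).trans_le hmn))
  have hempty : ⋂ n, s n = ∅ := by
    refine eq_empty_of_forall_notMem fun x hx ↦ ?_
    rw [mem_iInter] at hx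
    obtain ⟨n, hn⟩ := mem_iUnion.1 (hsub (hx 0).1)
    exact (hx (n + 1)).2 (mem_iUnion₂.2 ⟨n, by simp, hn⟩)
  have hlim := tendsto_projectiveFamilyContent_zero hP hs hanti hempty (by simpa [s] using hfin)
  have hle : ∀ n, projectiveFamilyContent hP B
      ≤ projectiveFamilyContent hP (s n) + ∑' n, projectiveFamilyContent hP (f n) := fun n ↦ by
    calc projectiveFamilyContent hP B
        ≤ projectiveFamilyContent hP (s n ∪ ⋃ i ∈ Finset.range n, f i) :=
          projectiveFamilyContent_mono hP hB (union_mem_measurableCylinders (hs n) (hU n))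
            (by simp [s])
      _ ≤ projectiveFamilyContent hP (s n)
            + projectiveFamilyContent hP (⋃ i ∈ Finset.range n, f i) :=
          addContent_union_le isSetRing_measurableCylinders (hs n) (hU n)
      _ ≤ _ := by
          gcongr
          exact (addContent_biUnion_le isSetRing_measurableCylinders fun i _ ↦ hf i).trans
            (ENNReal.sum_le_tsum _)
  simpa using ge_of_tendsto' (hlim.add_const _) hle

/-- An extension theorem for projective families of possibly infinite measures: a projective limit
exists if, for every countable union of cylinders that is again a cylinder, either its content is
approximated from inside by finite contents of cylinders, or a member has infinite content. -/
theorem exists_isProjectiveLimit (hP : IsProjectiveMeasureFamily P)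
    (hsub : ∀ ⦃f : ℕ → Set (∀ i, X i)⦄, (∀ n, f n ∈ measurableCylinders X) →
      (⋃ n, f n) ∈ measurableCylinders X →
      (∀ c < projectiveFamilyContent hP (⋃ n, f n), ∃ B ∈ measurableCylinders X,
        B ⊆ (⋃ n, f n) ∧ projectiveFamilyContent hP B ≠ ∞ ∧ c < projectiveFamilyContent hP B) ∨
      ∃ n, projectiveFamilyContent hP (f n) = ∞) :
    ∃ μ : Measure (∀ i, X i), IsProjectiveLimit μ P := by
  have hσ : (projectiveFamilyContent hP).IsSigmaSubadditive := by
    intro f hf hfU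
    rcases hsub hf hfU with h | ⟨n, hn⟩
    · refine le_of_forall_lt fun c hc ↦ ?_
      obtain ⟨B, hB, hBU, hBfin, hcB⟩ := h c hc
      exact hcB.trans_le (projectiveFamilyContent_le_tsum hP hB hBfin hf hBU)
    · rw [ENNReal.tsum_eq_top_of_eq_top ⟨n, hn⟩]
      exact le_top
  refine ⟨(projectiveFamilyContent hP).measure isSetSemiring_measurableCylinders
    generateFrom_measurableCylinders.ge hσ, fun I ↦ ?_⟩
  ext S hS
  rw [Measure.map_apply (Finset.measurable_restrict I) hS]
  change AddContent.measure _ _ _ _ (cylinder I S) = _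
  rw [AddContent.measure_eq _ _ generateFrom_measurableCylinders.symm hσ
    (cylinder_mem_measurableCylinders I S hS), projectiveFamilyContent_cylinder hP hS]

end ProjectiveExtension

/-! ### Uniqueness of the characteristic triplet -/

section Uniqueness

/-- Two continuous functions with the same exponential that agree at a point are equal. -/
lemma eq_of_cexp_comp_eq {E : Type*} [TopologicalSpace E] [PreconnectedSpace E] {f g : E → ℂ}
    (hf : Continuous f) (hg : Continuous g) (h : ∀ x, Complex.exp (f x) = Complex.exp (g x))
    {a : E} (ha : f a = g a) : f = g :=
  -- Both functions lift one map through the covering exp onto ℂ \ {0}, and on a preconnected space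
  -- one value determines a lift.
  Complex.isCoveringMap_exp.eq_of_comp_eq hf hg (funext fun x ↦ Subtype.ext (h x)) a ha

/-- Measures with equal densities agree where the density does not vanish. -/
lemma restrict_eq_of_withDensity_eq {α : Type*} [MeasurableSpace α] {μ ν : Measure α}
    {f : α → ℝ≥0∞} (hf : Measurable f) (hf_top : ∀ x, f x ≠ ∞)
    (h : μ.withDensity f = ν.withDensity f) {s : Set α} (hs : MeasurableSet s)
    (h0 : ∀ x ∈ s, f x ≠ 0) : μ.restrict s = ν.restrict s := by
  have key : ∀ ρ : Measure α,
      ρ.restrict s = ((ρ.withDensity f).restrict s).withDensity fun x ↦ (f x)⁻¹ := fun ρ ↦ by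
    rw [restrict_withDensity hs, withDensity_inv_same hf
      ((ae_restrict_iff' hs).2 (ae_of_all _ h0)) (ae_of_all _ hf_top)]
  rw [key μ, key ν, h]

namespace IDField

lemma continuous_trunc {ι : Type*} : Continuous (trunc : EuclideanSpace ℝ ι → EuclideanSpace ℝ ι) := by
  unfold trunc
  refine (PiLp.continuous_toLp 2 _).comp (continuous_pi fun i ↦ ?_)
  refine Continuous.div (by fun_prop) (by fun_prop) fun x ↦ ?_
  positivity

variable {ι : Type*} [Fintype ι]

/-- The integrand of the Lévy–Khintchine exponent. -/
noncomputable def levyIntegrand (θ x : EuclideanSpace ℝ ι) : ℂ :=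
  Complex.exp (Complex.I * (inner ℝ θ x : ℝ)) - 1 - Complex.I * (inner ℝ θ (trunc x) : ℝ)

lemma continuous_levyIntegrand_right (θ : EuclideanSpace ℝ ι) : Continuous (levyIntegrand θ) := by
  unfold levyIntegrand
  have := continuous_trunc (ι := ι)
  fun_prop

lemma continuous_levyIntegrand_left (x : EuclideanSpace ℝ ι) :
    Continuous fun θ ↦ levyIntegrand θ x := by
  unfold levyIntegrand
  fun_prop

lemma abs_inner_trunc_le (θ x : EuclideanSpace ℝ ι) :
    |inner ℝ θ (trunc x)| ≤ Fintype.card ι * ‖θ‖ := by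
  rw [PiLp.inner_apply]
  refine (Finset.abs_sum_le_sum_abs _ _).trans ?_
  calc _ ≤ ∑ _i : ι, ‖θ‖ := Finset.sum_le_sum fun i _ ↦ ?_
    _ = _ := by simp
  have h1 : |trunc x i| ≤ 1 := by
    have hpos : 0 < max 1 |x i| := by positivity
    simp only [trunc, abs_div, abs_of_pos hpos]
    exact (div_le_one hpos).2 (le_max_right _ _)
  have h2 : |θ i| ≤ ‖θ‖ := PiLp.norm_apply_le θ i
  simp only [RCLike.inner_apply, conj_trivial, abs_mul]
  nlinarith [abs_nonneg (θ i), abs_nonneg (trunc x i)]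

lemma trunc_eq_self {x : EuclideanSpace ℝ ι} (hx : ‖x‖ ≤ 1) : trunc x = x := by
  ext i
  have : |x i| ≤ 1 := (PiLp.norm_apply_le x i).trans hx
  simp [trunc, max_eq_left this]

lemma norm_cexp_sub_one_sub_le (a : ℝ) :
    ‖Complex.exp (Complex.I * a) - 1 - Complex.I * a‖ ≤ 2 * a ^ 2 := by
  rcases le_total |a| 1 with h | h
  · have := Complex.norm_exp_sub_one_sub_id_le (x := Complex.I * a) (by simpa using h)
    have h2 : ‖Complex.I * (a : ℂ)‖ ^ 2 = a ^ 2 := by simp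
    nlinarith [sq_nonneg a]
  · have h1 : ‖Complex.exp (Complex.I * a) - 1‖ ≤ |a| := Real.norm_exp_I_mul_ofReal_sub_one_le
    have h2 : ‖Complex.I * (a : ℂ)‖ = |a| := by simp
    have := norm_sub_le (Complex.exp (Complex.I * a) - 1) (Complex.I * a)
    nlinarith [sq_abs a]

/-- For small x the truncation is the identity and the Taylor bound gives 2R²; for large x the three
terms are bounded by 2 + card·R. Uniformity over the ball ‖θ‖ ≤ R is what dominated convergence
needs. -/
lemma norm_levyIntegrand_le {R : ℝ} {θ : EuclideanSpace ℝ ι} (hθ : ‖θ‖ ≤ R)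
    (x : EuclideanSpace ℝ ι) :
    ‖levyIntegrand θ x‖ ≤ (2 * R ^ 2 + 2 + Fintype.card ι * R) * min 1 (‖x‖ ^ 2) := by
  have hR : 0 ≤ R := (norm_nonneg θ).trans hθ
  have hcard : (0 : ℝ) ≤ Fintype.card ι * R := by positivity
  rcases le_total ‖x‖ 1 with h | h
  · rw [min_eq_right (by nlinarith [norm_nonneg x]), levyIntegrand, trunc_eq_self h]
    have h1 := norm_cexp_sub_one_sub_le (inner ℝ θ x)
    have h2 : |inner ℝ θ x| ≤ R * ‖x‖ :=
      (abs_real_inner_le_norm θ x).trans (by gcongr)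
    have h3 : (inner ℝ θ x) ^ 2 ≤ (R * ‖x‖) ^ 2 :=
      sq_le_sq' (by linarith [abs_le.1 h2]) (abs_le.1 h2).2
    nlinarith [sq_nonneg ‖x‖, mul_nonneg hcard (sq_nonneg ‖x‖)]
  · rw [min_eq_left (by nlinarith)]
    have h1 : ‖Complex.exp (Complex.I * (inner ℝ θ x : ℝ))‖ = 1 := by
      rw [mul_comm]; exact Complex.norm_exp_ofReal_mul_I _
    have h2 : ‖Complex.I * (inner ℝ θ (trunc x) : ℝ)‖ ≤ Fintype.card ι * R := by
      rw [norm_mul, Complex.norm_I, one_mul, Complex.norm_real, Real.norm_eq_abs]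
      exact (abs_inner_trunc_le θ x).trans (by gcongr)
    have h3 := norm_sub_le (Complex.exp (Complex.I * (inner ℝ θ x : ℝ)) - 1)
      (Complex.I * (inner ℝ θ (trunc x) : ℝ))
    have h4 := norm_sub_le (Complex.exp (Complex.I * (inner ℝ θ x : ℝ))) 1
    rw [norm_one] at h4
    unfold levyIntegrand
    nlinarith [sq_nonneg R]

lemma IsLevyMeasure.integrable_min {ν : Measure (EuclideanSpace ℝ ι)} (hν : IsLevyMeasure ν) :
    Integrable (fun x ↦ min 1 (‖x‖ ^ 2)) ν := by
  refine ⟨by fun_prop, ?_⟩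
  rw [hasFiniteIntegral_iff_ofReal (ae_of_all _ fun x ↦ by positivity)]
  exact hν.2

lemma IsLevyMeasure.integrable_levyIntegrand {ν : Measure (EuclideanSpace ℝ ι)}
    (hν : IsLevyMeasure ν) (θ : EuclideanSpace ℝ ι) : Integrable (levyIntegrand θ) ν :=
  (hν.integrable_min.const_mul _).mono' (continuous_levyIntegrand_right θ).aestronglyMeasurable
    (ae_of_all _ (norm_levyIntegrand_le le_rfl))

lemma IsLevyMeasure.continuous_integral_levyIntegrand {ν : Measure (EuclideanSpace ℝ ι)}
    (hν : IsLevyMeasure ν) : Continuous fun θ ↦ ∫ x, levyIntegrand θ x ∂ν := by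
  refine continuous_iff_continuousAt.2 fun θ₀ ↦ ?_
  refine continuousAt_of_dominated
    (Eventually.of_forall fun θ ↦ (continuous_levyIntegrand_right θ).aestronglyMeasurable)
    ?_ (hν.integrable_min.const_mul
      (2 * (‖θ₀‖ + 1) ^ 2 + 2 + Fintype.card ι * (‖θ₀‖ + 1)))
    (ae_of_all _ fun x ↦ (continuous_levyIntegrand_left x).continuousAt)
  filter_upwards [(continuous_norm.tendsto θ₀).eventually_le_const (lt_add_one ‖θ₀‖)] with θ hθ
  exact ae_of_all _ (norm_levyIntegrand_le hθ)

lemma levyExponent_eq (γ : EuclideanSpace ℝ ι) (B : Matrix ι ι ℝ)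
    (ν : Measure (EuclideanSpace ℝ ι)) (θ : EuclideanSpace ℝ ι) :
    levyExponent γ B ν θ = Complex.I * (inner ℝ θ γ : ℝ)
      - (1 / 2 : ℂ) * ((θ.ofLp ⬝ᵥ B *ᵥ θ.ofLp : ℝ) : ℂ) + ∫ x, levyIntegrand θ x ∂ν := rfl

lemma levyExponent_zero (γ : EuclideanSpace ℝ ι) (B : Matrix ι ι ℝ)
    (ν : Measure (EuclideanSpace ℝ ι)) : levyExponent γ B ν 0 = 0 := by
  simp [levyExponent]

lemma continuous_levyExponent (γ : EuclideanSpace ℝ ι) (B : Matrix ι ι ℝ)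
    {ν : Measure (EuclideanSpace ℝ ι)} (hν : IsLevyMeasure ν) :
    Continuous (levyExponent γ B ν) := by
  have h := hν.continuous_integral_levyIntegrand
  have hq : Continuous fun θ : EuclideanSpace ℝ ι ↦ θ.ofLp ⬝ᵥ B *ᵥ θ.ofLp := by
    have h0 : Continuous fun θ : EuclideanSpace ℝ ι ↦ θ.ofLp := PiLp.continuous_ofLp 2 _
    exact h0.dotProduct (continuous_const.matrix_mulVec h0)
  change Continuous fun θ ↦ Complex.I * (inner ℝ θ γ : ℝ)
      - (1 / 2 : ℂ) * ((θ.ofLp ⬝ᵥ B *ᵥ θ.ofLp : ℝ) : ℂ) + ∫ x, levyIntegrand θ x ∂ν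
  fun_prop

/-- The constant and the compensator are affine in θ, so they cancel, and only a nonnegative weight
times a character remains. -/
lemma levyIntegrand_second_difference (θ h x : EuclideanSpace ℝ ι) :
    levyIntegrand θ x - 1 / 2 * (levyIntegrand (θ + h) x + levyIntegrand (θ - h) x)
      = (1 - Real.cos (inner ℝ h x) : ℝ) • Complex.exp ((inner ℝ x θ : ℝ) * Complex.I) := by
  simp only [levyIntegrand, inner_add_left, inner_sub_left, real_inner_comm θ x, mul_sub, mul_add,
    Complex.ofReal_add, Complex.ofReal_sub, Complex.exp_add, Complex.exp_sub, Complex.real_smul,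
    Complex.ofReal_cos, Complex.cos, Complex.ofReal_one]
  rw [mul_comm Complex.I (inner ℝ θ x : ℂ), mul_comm Complex.I (inner ℝ h x : ℂ), neg_mul,
    Complex.exp_neg]
  ring

/-- The finite measure `(1 - cos⟨h, x⟩) ν(dx) + ½⟨h, Bh⟩ δ₀`, whose characteristic function is a
second difference of the Lévy–Khintchine exponent. -/
noncomputable def differenceMeasure (B : Matrix ι ι ℝ) (ν : Measure (EuclideanSpace ℝ ι))
    (h : EuclideanSpace ℝ ι) : Measure (EuclideanSpace ℝ ι) :=
  ν.withDensity (fun x ↦ ENNReal.ofReal (1 - Real.cos (inner ℝ h x)))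
    + ENNReal.ofReal (1 / 2 * (h.ofLp ⬝ᵥ B *ᵥ h.ofLp)) • Measure.dirac 0

lemma IsLevyMeasure.isFiniteMeasure_withDensity {ν : Measure (EuclideanSpace ℝ ι)}
    (hν : IsLevyMeasure ν) (h : EuclideanSpace ℝ ι) :
    IsFiniteMeasure
      (ν.withDensity fun x ↦ ENNReal.ofReal (1 - Real.cos (inner ℝ h x))) := by
  refine isFiniteMeasure_withDensity_ofReal ?_
  -- The density is minus the real part of the integrand at h.
  have hint := (hν.integrable_levyIntegrand h).re.neg.2
  convert hint using 2 with x
  simp [levyIntegrand, Complex.exp_re]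

lemma charFun_differenceMeasure (γ : EuclideanSpace ℝ ι) {B : Matrix ι ι ℝ} (hB : B.PosSemidef)
    {ν : Measure (EuclideanSpace ℝ ι)} (hν : IsLevyMeasure ν) (θ h : EuclideanSpace ℝ ι) :
    charFun (differenceMeasure B ν h) θ = levyExponent γ B ν θ
      - 1 / 2 * (levyExponent γ B ν (θ + h) + levyExponent γ B ν (θ - h)) := by
  have hfin := hν.isFiniteMeasure_withDensity h
  have hq : 0 ≤ h.ofLp ⬝ᵥ B *ᵥ h.ofLp := by
    simpa using hB.dotProduct_mulVec_nonneg h.ofLp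
  have hcont : Continuous fun x : EuclideanSpace ℝ ι ↦ Complex.exp ((inner ℝ x θ : ℝ) * Complex.I) := by
    fun_prop
  have hbdd : ∀ (μ : Measure (EuclideanSpace ℝ ι)) [IsFiniteMeasure μ],
      Integrable (fun x ↦ Complex.exp ((inner ℝ x θ : ℝ) * Complex.I)) μ := fun μ _ ↦
    (integrable_const (1 : ℝ)).mono' hcont.aestronglyMeasurable
      (ae_of_all _ fun x ↦ (Complex.norm_exp_ofReal_mul_I _).le)
  have hjump : ∫ x, Complex.exp ((inner ℝ x θ : ℝ) * Complex.I)
        ∂(ν.withDensity fun x ↦ ENNReal.ofReal (1 - Real.cos (inner ℝ h x)))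
      = ∫ x, levyIntegrand θ x ∂ν - 1 / 2 *
        (∫ x, levyIntegrand (θ + h) x ∂ν + ∫ x, levyIntegrand (θ - h) x ∂ν) := by
    have hsum : Integrable
        (fun x ↦ 1 / 2 * (levyIntegrand (θ + h) x + levyIntegrand (θ - h) x)) ν :=
      ((hν.integrable_levyIntegrand _).add (hν.integrable_levyIntegrand _)).const_mul _
    rw [integral_withDensity_eq_integral_toReal_smul (by fun_prop) (by simp),
      ← integral_add (hν.integrable_levyIntegrand _) (hν.integrable_levyIntegrand _),
      ← integral_const_mul, ← integral_sub (hν.integrable_levyIntegrand _) hsum]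
    refine integral_congr_ae (ae_of_all _ fun x ↦ ?_)
    beta_reduce
    rw [levyIntegrand_second_difference,
      ENNReal.toReal_ofReal (by linarith [Real.cos_le_one (inner ℝ h x)])]
  rw [charFun_apply, differenceMeasure, integral_add_measure (hbdd _)
    ((hbdd _).smul_measure ENNReal.ofReal_ne_top), hjump, integral_smul_measure, integral_dirac,
    ENNReal.toReal_ofReal (by positivity)]
  simp only [levyExponent_eq, inner_add_left, inner_sub_left, WithLp.ofLp_add, WithLp.ofLp_sub,
    Matrix.mulVec_add, Matrix.mulVec_sub, add_dotProduct, sub_dotProduct, dotProduct_add,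
    dotProduct_sub, inner_zero_left]
  simp
  ring

instance isFiniteMeasure_ofReal_smul_dirac (c : ℝ) (a : EuclideanSpace ℝ ι) :
    IsFiniteMeasure (ENNReal.ofReal c • Measure.dirac a) :=
  Measure.smul_finite _ ENNReal.ofReal_ne_top

lemma IsLevyMeasure.restrict_compl_zero {ν : Measure (EuclideanSpace ℝ ι)}
    (hν : IsLevyMeasure ν) : ν.restrict {0}ᶜ = ν :=
  Measure.restrict_eq_self_of_ae_mem (by simpa [ae_iff] using hν.1)

/-- A Lévy measure is determined by the measures `(1 - cos⟨h, x⟩) ν(dx)`. -/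
lemma IsLevyMeasure.ext {ν ν' : Measure (EuclideanSpace ℝ ι)} (hν : IsLevyMeasure ν)
    (hν' : IsLevyMeasure ν')
    (heq : ∀ h, ν.withDensity (fun x ↦ ENNReal.ofReal (1 - Real.cos (inner ℝ h x)))
      = ν'.withDensity (fun x ↦ ENNReal.ofReal (1 - Real.cos (inner ℝ h x)))) : ν = ν' := by
  classical
  -- Since cos⟨h, x⟩ = 1 also at nonzero multiples of 2π, one h does not suffice. With h = e_i/(n+1)
  -- and |x_i| < n, the inner product lies in (-1, 1), so the weight vanishes only if x_i = 0.
  let e : ι × ℕ → EuclideanSpace ℝ ι := fun p ↦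
    EuclideanSpace.single p.1 ((p.2 + 1 : ℝ)⁻¹)
  let S : ι × ℕ → Set (EuclideanSpace ℝ ι) := fun p ↦ {x | Real.cos (inner ℝ (e p) x) < 1}
  have hS : ∀ p, MeasurableSet (S p) := fun p ↦
    measurableSet_lt (by fun_prop) measurable_const
  have hcover : {0}ᶜ ⊆ ⋃ p, S p := by
    intro x hx
    obtain ⟨i, hi⟩ : ∃ i, x i ≠ 0 := by
      by_contra! h
      exact hx (PiLp.ext h)
    obtain ⟨n, hn⟩ := exists_nat_gt |x i|
    have hn1 : (0 : ℝ) < n + 1 := by positivity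
    refine mem_iUnion.2 ⟨(i, n), lt_of_le_of_ne (Real.cos_le_one _) fun hcos ↦ hi ?_⟩
    have hval : inner ℝ (e (i, n)) x = x i / (n + 1) := by
      simp [e, EuclideanSpace.inner_single_left]; ring
    rw [hval] at hcos
    have hlt : |x i / (n + 1)| < 1 := by
      rw [abs_div, abs_of_pos hn1, div_lt_one hn1]; linarith
    have := (Real.cos_eq_one_iff_of_lt_of_lt
      (by linarith [(abs_lt.1 hlt).1, Real.pi_gt_three])
      (by linarith [(abs_lt.1 hlt).2, Real.pi_gt_three])).1 hcos
    simpa [hn1.ne'] using this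
  have hres : ν.restrict (⋃ p, S p) = ν'.restrict (⋃ p, S p) := by
    refine Measure.restrict_iUnion_congr.2 fun p ↦ ?_
    refine restrict_eq_of_withDensity_eq (by fun_prop) (by simp) (heq (e p)) (hS p) fun x hx ↦ ?_
    simpa [ENNReal.ofReal_eq_zero] using (show Real.cos (inner ℝ (e p) x) < 1 from hx)
  rw [← hν.restrict_compl_zero, ← hν'.restrict_compl_zero]
  exact Measure.restrict_congr_mono hcover hres

/-- Uniqueness of the characteristic triplet. -/
theorem IsCharTriplet.unique {μ : Measure (EuclideanSpace ℝ ι)} {γ γ' : EuclideanSpace ℝ ι}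
    {B B' : Matrix ι ι ℝ} {ν ν' : Measure (EuclideanSpace ℝ ι)} (h : IsCharTriplet μ γ B ν)
    (h' : IsCharTriplet μ γ' B' ν') : γ = γ' ∧ B = B' ∧ ν = ν' := by
  obtain ⟨hB, hν, hμ⟩ := h
  obtain ⟨hB', hν', hμ'⟩ := h'
  have hexp : levyExponent γ B ν = levyExponent γ' B' ν' :=
    eq_of_cexp_comp_eq (continuous_levyExponent γ B hν) (continuous_levyExponent γ' B' hν')
      (fun θ ↦ (hμ θ).symm.trans (hμ' θ)) (a := 0) (by simp only [levyExponent_zero])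
  have hdiff : ∀ h, differenceMeasure B ν h = differenceMeasure B' ν' h := fun h ↦ by
    have h1 := hν.isFiniteMeasure_withDensity h
    have h2 := hν'.isFiniteMeasure_withDensity h
    unfold differenceMeasure
    refine Measure.ext_of_charFun (funext fun θ ↦ ?_)
    refine (charFun_differenceMeasure γ hB hν θ h).trans ?_
    rw [hexp]
    exact (charFun_differenceMeasure γ' hB' hν' θ h).symm
  -- As ν has no mass at 0, the atom there isolates the Gaussian part.
  have hzero : ∀ (B : Matrix ι ι ℝ) {ν : Measure (EuclideanSpace ℝ ι)} (_ : IsLevyMeasure ν) h,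
      differenceMeasure B ν h {0} = ENNReal.ofReal (1 / 2 * (h.ofLp ⬝ᵥ B *ᵥ h.ofLp)) :=
    fun B ν hν h ↦ by
      have : ν.withDensity (fun x ↦ ENNReal.ofReal (1 - Real.cos (inner ℝ h x))) {0} = 0 :=
        withDensity_absolutelyContinuous ν _ hν.1
      simp [differenceMeasure, this]
  have hquad : ∀ v : ι → ℝ, v ⬝ᵥ B *ᵥ v = v ⬝ᵥ B' *ᵥ v := fun v ↦ by
    have h0 := congrArg (· {0}) (hdiff (WithLp.toLp 2 v))
    simp only [hzero _ hν, hzero _ hν'] at h0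
    have p1 : 0 ≤ v ⬝ᵥ B *ᵥ v := by simpa using hB.dotProduct_mulVec_nonneg v
    have p2 : 0 ≤ v ⬝ᵥ B' *ᵥ v := by simpa using hB'.dotProduct_mulVec_nonneg v
    have := (ENNReal.ofReal_eq_ofReal_iff (by positivity) (by positivity)).1 h0
    linarith
  -- Polarization, using symmetry of both matrices.
  have hBB : B = B' := by
    classical
    have hs : ∀ i j, B i j = B j i := fun i j ↦ by simpa using (hB.1.apply i j).symm
    have hs' : ∀ i j, B' i j = B' j i := fun i j ↦ by simpa using (hB'.1.apply i j).symm
    ext i j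
    have e1 := hquad (Pi.single i 1)
    have e2 := hquad (Pi.single j 1)
    have e3 := hquad (Pi.single i 1 + Pi.single j 1)
    simp only [Matrix.mulVec_add, add_dotProduct, dotProduct_add, Matrix.mulVec_single_one,
      single_one_dotProduct, Matrix.col_apply] at e1 e2 e3
    linarith [hs i j, hs' i j]
  subst hBB
  have hνν : ν = ν' := hν.ext hν' fun h ↦ by
    have := hdiff h
    unfold differenceMeasure at this
    exact (Measure.add_left_inj _ _ _).1 this
  subst hνν
  refine ⟨ext_inner_left ℝ fun θ ↦ ?_, rfl, rfl⟩
  have h0 := congrFun hexp θ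
  simp only [levyExponent, add_left_inj, sub_left_inj] at h0
  exact_mod_cast mul_left_cancel₀ Complex.I_ne_zero h0

end IDField

end Uniqueness

namespace IDField

/-! ### Triplets of marginal laws -/

section Marginals

/-- The projection of `ℝ^ι` to the coordinates selected by `e : κ → ι`. -/
noncomputable def reindexCoords {ι κ : Type*} (e : κ → ι) (x : EuclideanSpace ℝ ι) :
    EuclideanSpace ℝ κ :=
  WithLp.toLp 2 fun k ↦ x (e k)

lemma continuous_reindexCoords {ι κ : Type*} (e : κ → ι) : Continuous (reindexCoords e) := by
  unfold reindexCoords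
  fun_prop

/-- Truncation acts coordinatewise, so it commutes with projection; this is why the marginal drift
has no correction term. -/
lemma trunc_reindexCoords {ι κ : Type*} (e : κ → ι) (x : EuclideanSpace ℝ ι) :
    trunc (reindexCoords e x) = reindexCoords e (trunc x) := rfl

variable {ι κ : Type*} [Fintype ι] [Fintype κ]

lemma norm_reindexCoords_le {e : κ → ι} (he : e.Injective) (x : EuclideanSpace ℝ ι) :
    ‖reindexCoords e x‖ ≤ ‖x‖ := by
  refine le_of_sq_le_sq ?_ (norm_nonneg x)
  rw [EuclideanSpace.norm_sq_eq, EuclideanSpace.norm_sq_eq]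
  have := Finset.sum_map Finset.univ ⟨e, he⟩ fun i ↦ ‖x i‖ ^ 2
  simp only [Function.Embedding.coeFn_mk] at this
  change ∑ k, ‖x (e k)‖ ^ 2 ≤ _
  rw [← this]
  exact Finset.sum_le_univ_sum_of_nonneg fun i ↦ by positivity

lemma extend_dotProduct {e : κ → ι} (he : e.Injective) (θ : κ → ℝ) (v : ι → ℝ) :
    Function.extend e θ 0 ⬝ᵥ v = θ ⬝ᵥ (v ∘ e) := by
  refine (Fintype.sum_of_injective e he _ _ (fun i hi ↦ ?_) fun k ↦ ?_).symm
  · rw [Function.extend_apply' _ _ _ (by simpa using hi)]; simp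
  · rw [he.extend_apply]; rfl

/-- The extension of a vector by zero, adjoint to `reindexCoords`. -/
noncomputable def extendCoords {ι κ : Type*} (e : κ → ι) (θ : EuclideanSpace ℝ κ) :
    EuclideanSpace ℝ ι :=
  WithLp.toLp 2 (Function.extend e θ.ofLp 0)

lemma inner_extendCoords {e : κ → ι} (he : e.Injective) (θ : EuclideanSpace ℝ κ)
    (x : EuclideanSpace ℝ ι) :
    inner ℝ (extendCoords e θ) x = inner ℝ θ (reindexCoords e x) := by
  have h := extend_dotProduct he θ.ofLp x.ofLp
  simp only [EuclideanSpace.inner_eq_star_dotProduct, star_trivial, extendCoords, reindexCoords]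
  rw [dotProduct_comm, h, dotProduct_comm]
  rfl

lemma extendCoords_quadratic {e : κ → ι} (he : e.Injective) (B : Matrix ι ι ℝ)
    (θ : EuclideanSpace ℝ κ) :
    (extendCoords e θ).ofLp ⬝ᵥ B *ᵥ (extendCoords e θ).ofLp
      = θ.ofLp ⬝ᵥ B.submatrix e e *ᵥ θ.ofLp := by
  simp only [extendCoords]
  rw [extend_dotProduct he]
  congr 1
  ext k
  simp only [Function.comp_apply, Matrix.mulVec]
  rw [dotProduct_comm, extend_dotProduct he, dotProduct_comm]
  rfl

/-- The characteristic triplet of a marginal law. -/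
lemma IsCharTriplet.map_reindexCoords {μ : Measure (EuclideanSpace ℝ ι)}
    {γ : EuclideanSpace ℝ ι} {B : Matrix ι ι ℝ} {ν : Measure (EuclideanSpace ℝ ι)}
    (h : IsCharTriplet μ γ B ν) {e : κ → ι} (he : e.Injective) :
    IsCharTriplet (μ.map (reindexCoords e)) (reindexCoords e γ) (B.submatrix e e)
      ((ν.map (reindexCoords e)).restrict {0}ᶜ) := by
  have hr := continuous_reindexCoords e
  refine ⟨h.posSemidef.submatrix e, ⟨?_, ?_⟩, fun θ ↦ ?_⟩
  · rw [Measure.restrict_apply (measurableSet_singleton 0)]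
    simp
  · refine lt_of_le_of_lt ?_ h.isLevyMeasure.2
    refine (lintegral_mono' Measure.restrict_le_self le_rfl).trans ?_
    rw [lintegral_map (by fun_prop) hr.measurable]
    refine lintegral_mono fun x ↦ ENNReal.ofReal_le_ofReal (min_le_min le_rfl ?_)
    gcongr
    exact norm_reindexCoords_le he x
  · have hchar : charFun (μ.map (reindexCoords e)) θ = charFun μ (extendCoords e θ) := by
      rw [charFun_apply, charFun_apply, integral_map hr.measurable.aemeasurable
        (by fun_prop)]
      refine integral_congr_ae (ae_of_all _ fun x ↦ ?_)
      simp only [real_inner_comm θ, real_inner_comm (extendCoords e θ), inner_extendCoords he]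
    -- The integrand vanishes at 0, so discarding the mass projected there changes nothing.
    have hint : ∫ x in {0}ᶜ, levyIntegrand θ x ∂(ν.map (reindexCoords e))
        = ∫ x, levyIntegrand (extendCoords e θ) x ∂ν := by
      rw [setIntegral_eq_integral_of_forall_compl_eq_zero, integral_map hr.measurable.aemeasurable
        (continuous_levyIntegrand_right θ).aestronglyMeasurable]
      · refine integral_congr_ae (ae_of_all _ fun x ↦ ?_)
        simp only [levyIntegrand, inner_extendCoords he, trunc_reindexCoords]
      · intro x hx
        obtain rfl : x = 0 := by simpa using hx
        rw [levyIntegrand, trunc_eq_self (by simp)]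
        simp
    rw [hchar, h.charFun_eq, levyExponent_eq, levyExponent_eq, hint, inner_extendCoords he,
      extendCoords_quadratic he]

end Marginals

/-! ### Consistency, and existence of the Lévy measure on ℝ^U -/

section System

variable {U Ω : Type*} [MeasurableSpace Ω] {X : U → Ω → ℝ} {P : Measure Ω}
  {γ : ∀ s : Finset U, EuclideanSpace ℝ s} {B : ∀ s : Finset U, Matrix s s ℝ}
  {νfd : ∀ s : Finset U, Measure (EuclideanSpace ℝ s)}

lemma measurable_proj {U : Type*} (s : Finset U) : Measurable (proj s) :=
  (WithLp.measurable_toLp 2 _).comp (Finset.measurable_restrict s)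

/-- The characteristic triplets of a field are consistent. -/
lemma IsTripletSystem.consistent (hX : ∀ u, Measurable (X u)) (hT : IsTripletSystem X P γ B νfd)
    {s t : Finset U} (hst : s ⊆ t) :
    γ s = reindexCoords (inclusion hst) (γ t) ∧
      B s = (B t).submatrix (inclusion hst) (inclusion hst) ∧
      νfd s = ((νfd t).map (reindexCoords (inclusion hst))).restrict {0}ᶜ := by
  refine (hT s).unique ?_
  have h := (hT t).map_reindexCoords (inclusion_injective hst)
  have hXt : Measurable fun ω ↦ proj t fun u ↦ X u ω :=
    (measurable_proj t).comp (measurable_pi_lambda _ hX)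
  rwa [Measure.map_map (continuous_reindexCoords _).measurable hXt] at h

lemma IsLevyMeasure.sigmaFinite {ι : Type*} [Fintype ι] {ν : Measure (EuclideanSpace ℝ ι)}
    (hν : IsLevyMeasure ν) : SigmaFinite ν := by
  have hfin : IsFiniteMeasure (ν.withDensity fun x ↦ ENNReal.ofReal (min 1 (‖x‖ ^ 2))) :=
    MeasureTheory.isFiniteMeasure_withDensity hν.2.ne
  have hpos : ∀ᵐ x ∂ν, ENNReal.ofReal (min 1 (‖x‖ ^ 2)) ≠ 0 := by
    have h0 : ∀ᵐ x ∂ν, x ≠ 0 := by simpa [ae_iff] using hν.1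
    filter_upwards [h0] with x hx
    have : 0 < ‖x‖ := norm_pos_iff.2 hx
    exact (ENNReal.ofReal_pos.2 (by positivity)).ne'
  -- ν is recovered from the finite measure (1 ∧ |x|²) ν by the reciprocal density, finite almost
  -- everywhere because ν({0}) = 0.
  rw [← withDensity_inv_same (by fun_prop) hpos (by simp)]
  refine SigmaFinite.withDensity_of_ne_top ?_
  exact (withDensity_absolutelyContinuous ν _).ae_le
    (hpos.mono fun x hx ↦ ENNReal.inv_ne_top.2 hx)

/-- The Lévy measures of the finite-dimensional marginals, with infinite mass added at the
origin. -/
noncomputable def augmentedLevyFamily {U : Type*}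
    (νfd : ∀ s : Finset U, Measure (EuclideanSpace ℝ s)) (s : Finset U) : Measure (s → ℝ) :=
  (νfd s).map WithLp.ofLp + (∞ : ℝ≥0∞) • Measure.dirac 0

lemma augmentedLevyFamily_apply_of_mem (s : Finset U) {S : Set (s → ℝ)} (h : 0 ∈ S) :
    augmentedLevyFamily νfd s S = ∞ := by
  simp [augmentedLevyFamily, h]

lemma augmentedLevyFamily_apply_of_notMem (s : Finset U) {S : Set (s → ℝ)} (hS : MeasurableSet S)
    (h : 0 ∉ S) : augmentedLevyFamily νfd s S = (νfd s).map WithLp.ofLp S := by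
  simp [augmentedLevyFamily, hS, h]

/-- Projecting the Lévy measure from t to s may leave mass at the origin, possibly infinite, which
`νfd s` lacks. The infinite atom absorbs it, as c + ∞ = ∞. -/
lemma isProjectiveMeasureFamily_augmentedLevyFamily (hX : ∀ u, Measurable (X u))
    (hT : IsTripletSystem X P γ B νfd) :
    IsProjectiveMeasureFamily (α := fun _ : U ↦ ℝ) (augmentedLevyFamily νfd) := by
  intro t s hst
  let r : EuclideanSpace ℝ t → EuclideanSpace ℝ s := reindexCoords (inclusion hst)
  have hr : Measurable r := (continuous_reindexCoords _).measurable
  have hof : ∀ s : Finset U, Measurable (WithLp.ofLp : EuclideanSpace ℝ s → s → ℝ) := fun s ↦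
    WithLp.measurable_ofLp 2 _
  have hre : Measurable (Finset.restrict₂ (π := fun _ : U ↦ ℝ) hst) :=
    Finset.measurable_restrict₂ hst
  let ρ : Measure (EuclideanSpace ℝ s) := (νfd t).map r
  have hρ : ρ = νfd s + ρ {0} • Measure.dirac 0 := by
    rw [(hT.consistent hX hst).2.2, ← Measure.restrict_singleton, add_comm]
    exact (Measure.restrict_add_restrict_compl (measurableSet_singleton 0)).symm
  have hmap : ((νfd t).map WithLp.ofLp).map (Finset.restrict₂ (π := fun _ : U ↦ ℝ) hst)
      = ρ.map WithLp.ofLp := by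
    rw [Measure.map_map hre (hof t), Measure.map_map (hof s) hr]
    rfl
  rw [augmentedLevyFamily, augmentedLevyFamily, Measure.map_add _ _ hre, hmap, hρ,
    Measure.map_add _ _ (hof s), Measure.map_smul, Measure.map_smul, Measure.map_dirac' (hof s),
    Measure.map_dirac' hre, add_assoc]
  congr 1
  change _ = _ • Measure.dirac 0 + (∞ : ℝ≥0∞) • Measure.dirac 0
  rw [← add_smul, add_top]

/-- Existence of a Lévy measure on `ℝ^U`. -/
lemma IsTripletSystem.exists_projectsOnto (hX : ∀ u, Measurable (X u))
    (hT : IsTripletSystem X P γ B νfd) : ∃ ν : Measure (U → ℝ), ProjectsOnto ν νfd := by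
  have hP := isProjectiveMeasureFamily_augmentedLevyFamily hX hT
  obtain ⟨ν, hν⟩ := exists_isProjectiveLimit hP fun f hf hfU ↦ by
    obtain ⟨I, S, hS, hIS⟩ := (mem_measurableCylinders _).1 hfU
    -- If the union contains the zero path, so does some member, whose content is then infinite;
    -- otherwise no atom is involved and σ-finiteness yields the finite approximations.
    by_cases h0 : (0 : I → ℝ) ∈ S
    · right
      have h0U : (0 : U → ℝ) ∈ ⋃ n, f n := by rw [hIS]; exact h0
      obtain ⟨n, hn⟩ := mem_iUnion.1 h0U
      obtain ⟨J, T, hT, hJT⟩ := (mem_measurableCylinders _).1 (hf n)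
      refine ⟨n, ?_⟩
      rw [hJT] at hn ⊢
      rw [projectiveFamilyContent_cylinder hP hT]
      exact augmentedLevyFamily_apply_of_mem J hn
    · left
      rw [hIS]
      intro c hc
      have := (hT I).isLevyMeasure.sigmaFinite
      have : SigmaFinite ((νfd I).map WithLp.ofLp) :=
        (MeasurableEquiv.toLp 2 (I → ℝ)).symm.sigmaFinite_map
      rw [projectiveFamilyContent_cylinder hP hS, augmentedLevyFamily_apply_of_notMem I hS h0] at hc
      obtain ⟨T, hT, hTS, hcT, hTfin⟩ := Measure.exists_subset_measure_lt_top hS hc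
      have h0T : (0 : I → ℝ) ∉ T := fun h ↦ h0 (hTS h)
      refine ⟨cylinder I T, cylinder_mem_measurableCylinders (α := fun _ : U ↦ ℝ) I T hT,
        preimage_mono hTS, ?_⟩
      rw [projectiveFamilyContent_cylinder hP hT, augmentedLevyFamily_apply_of_notMem I hT h0T]
      exact ⟨hTfin.ne, hcT⟩
  refine ⟨ν, fun s A hA h0 ↦ ?_⟩
  have hA' : MeasurableSet (WithLp.toLp 2 ⁻¹' A : Set (s → ℝ)) := WithLp.measurable_toLp 2 _ hA
  have h1 := hν.measure_cylinder s hA'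
  rw [augmentedLevyFamily_apply_of_notMem s hA' h0,
    Measure.map_apply (WithLp.measurable_ofLp 2 _) hA'] at h1
  exact h1.symm

lemma ProjectsOnto.restrict_map {ν : Measure (U → ℝ)} (h : ProjectsOnto ν νfd) (s : Finset U) :
    (ν.map (proj s)).restrict {0}ᶜ = (νfd s).restrict {0}ᶜ := by
  ext A hA
  have hA' : MeasurableSet (A ∩ {0}ᶜ) := hA.inter (measurableSet_singleton 0).compl
  rw [Measure.restrict_apply hA, Measure.restrict_apply hA,
    Measure.map_apply (measurable_proj s) hA', h s _ hA' (by simp)]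

/-- The integrand depends only on x_u and vanishes with it, so only the part of `νfd {u}` off the
origin enters. -/
lemma ProjectsOnto.lintegral_min_lt_top {ν : Measure (U → ℝ)} (h : ProjectsOnto ν νfd)
    (hν : ∀ s, IsLevyMeasure (νfd s)) (u : U) :
    ∫⁻ x, ENNReal.ofReal (min 1 (|x u| ^ 2)) ∂ν < ⊤ := by
  let v : ({u} : Finset U) := ⟨u, Finset.mem_singleton_self u⟩
  let g : EuclideanSpace ℝ ({u} : Finset U) → ℝ≥0∞ := fun y ↦ ENNReal.ofReal (min 1 (|y v| ^ 2))
  have hg : Measurable g := by fun_prop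
  have hg0 : ∀ y ∉ ({0}ᶜ : Set (EuclideanSpace ℝ ({u} : Finset U))), g y = 0 := by
    intro y hy
    obtain rfl : y = 0 := by simpa using hy
    simp [g]
  calc ∫⁻ x, ENNReal.ofReal (min 1 (|x u| ^ 2)) ∂ν
      = ∫⁻ y, g y ∂(ν.map (proj {u})) := by
        rw [lintegral_map hg (measurable_proj _)]; rfl
    _ = ∫⁻ y in {0}ᶜ, g y ∂(ν.map (proj {u})) :=
        (setLIntegral_eq_of_support_subset fun y hy ↦ by_contra fun h ↦ hy (hg0 y h)).symm
    _ = ∫⁻ y in {0}ᶜ, g y ∂(νfd {u}) := by rw [h.restrict_map]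
    _ ≤ ∫⁻ y, g y ∂(νfd {u}) := setLIntegral_le_lintegral _ _
    _ ≤ ∫⁻ y, ENNReal.ofReal (min 1 (‖y‖ ^ 2)) ∂(νfd {u}) := by
        refine lintegral_mono fun y ↦ ENNReal.ofReal_le_ofReal (min_le_min le_rfl ?_)
        gcongr
        exact PiLp.norm_apply_le y v
    _ < ⊤ := (hν {u}).2

/-! ### Uniqueness of the Lévy measure not charging zero -/

/-- The paths whose coordinate at `u` exceeds `1 / (n + 1)` in absolute value. -/
def largeAt {U : Type*} (p : U × ℕ) : Set (U → ℝ) := {x | ((p.2 : ℝ) + 1)⁻¹ < |x p.1|}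

/-- Markov's inequality for 1 ∧ |x_u|². -/
lemma ProjectsOnto.measure_largeAt_lt_top {ν : Measure (U → ℝ)} (h : ProjectsOnto ν νfd)
    (hν : ∀ s, IsLevyMeasure (νfd s)) (p : U × ℕ) : ν (largeAt p) < ∞ := by
  set c : ℝ := ((p.2 : ℝ) + 1)⁻¹
  have hc : 0 < c := by positivity
  have hc' : ENNReal.ofReal (min 1 (c ^ 2)) ≠ 0 := (ENNReal.ofReal_pos.2 (by positivity)).ne'
  refine lt_of_le_of_lt (measure_mono fun x (hx : c < |x p.1|) ↦ ?_)
    ((meas_ge_le_lintegral_div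
      (f := fun x : U → ℝ ↦ ENNReal.ofReal (min 1 (|x p.1| ^ 2)))
      (Measurable.aemeasurable (by fun_prop)) (ε := ENNReal.ofReal (min 1 (c ^ 2))) hc'
      ENNReal.ofReal_ne_top).trans_lt
      (ENNReal.div_lt_top (h.lintegral_min_lt_top hν p.1).ne hc'))
  exact ENNReal.ofReal_le_ofReal (min_le_min le_rfl (by gcongr))

/-- A cylinder met with `largeAt p` is a cylinder over one more coordinate whose base misses the
origin, so the projections determine its mass. Finiteness then allows the π-system argument. -/
lemma ProjectsOnto.restrict_largeAt_eq {ν ν' : Measure (U → ℝ)} (h : ProjectsOnto ν νfd)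
    (h' : ProjectsOnto ν' νfd) (hν : ∀ s, IsLevyMeasure (νfd s)) (p : U × ℕ) :
    ν.restrict (largeAt p) = ν'.restrict (largeAt p) := by
  classical
  have hfin : IsFiniteMeasure (ν.restrict (largeAt p)) :=
    ⟨by simpa using h.measure_largeAt_lt_top hν p⟩
  have hcyl : ∀ s ∈ measurableCylinders fun _ : U ↦ ℝ,
      ν.restrict (largeAt p) s = ν'.restrict (largeAt p) s := by
    intro s hs
    obtain ⟨I, S, hS, rfl⟩ := (mem_measurableCylinders _).1 hs
    rw [Measure.restrict_apply (hS.cylinder I), Measure.restrict_apply (hS.cylinder I)]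
    let J := insert p.1 I
    let v : J := ⟨p.1, Finset.mem_insert_self _ _⟩
    let A : Set (EuclideanSpace ℝ J) :=
      {y | Finset.restrict₂ (π := fun _ : U ↦ ℝ) (Finset.subset_insert p.1 I) y.ofLp ∈ S ∧
        ((p.2 : ℝ) + 1)⁻¹ < |y v|}
    have hre : Measurable fun y : EuclideanSpace ℝ J ↦
        Finset.restrict₂ (π := fun _ : U ↦ ℝ) (Finset.subset_insert p.1 I) y.ofLp :=
      (Finset.measurable_restrict₂ _).comp (WithLp.measurable_ofLp 2 _)
    have hv : Measurable fun y : EuclideanSpace ℝ J ↦ |y v| := by fun_prop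
    have hA : MeasurableSet A := (hre hS).inter (measurableSet_lt measurable_const hv)
    have h0 : (0 : EuclideanSpace ℝ J) ∉ A := fun hmem ↦ by
      have h1 := hmem.2
      simp only [PiLp.zero_apply, abs_zero] at h1
      exact absurd h1 (not_lt.2 (by positivity))
    exact (h J A hA h0).symm.trans (h' J A hA h0)
  exact ext_of_generate_finite _ generateFrom_measurableCylinders.symm
    isPiSystem_measurableCylinders hcyl (hcyl _ (univ_mem_measurableCylinders _))

/-- At most one Lévy measure on `ℝ^U` does not charge zero. -/
lemma ProjectsOnto.eq_of_doesNotChargeZero {ν ν' : Measure (U → ℝ)} (h : ProjectsOnto ν νfd)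
    (h' : ProjectsOnto ν' νfd) (hν : ∀ s, IsLevyMeasure (νfd s)) (h0 : DoesNotChargeZero ν)
    (h0' : DoesNotChargeZero ν') : ν' = ν := by
  obtain ⟨V, hV, hVν⟩ := h0
  obtain ⟨V', hV', hVν'⟩ := h0'
  have hc : Countable ↑(V ∪ V') := (hV.union hV').to_subtype
  -- Off the union of these countably many sets a path vanishes on both V and V', so the union
  -- carries both measures.
  let E : ↑(V ∪ V') × ℕ → Set (U → ℝ) := fun q ↦ largeAt (q.1.1, q.2)
  have hcompl : ∀ W ⊆ V ∪ V', (⋃ q, E q)ᶜ ⊆ {x | ∀ u ∈ W, x u = 0} := by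
    intro W hW x hx u hu
    by_contra hne
    obtain ⟨n, hn⟩ := exists_nat_one_div_lt (abs_pos.2 hne)
    exact hx (mem_iUnion.2 ⟨(⟨u, hW hu⟩, n), by simpa [E, largeAt] using hn⟩)
  have hself : ∀ {ρ : Measure (U → ℝ)} {W : Set U}, W ⊆ V ∪ V' →
      ρ {x | ∀ u ∈ W, x u = 0} = 0 → ρ.restrict (⋃ q, E q) = ρ := fun hW hρ ↦
    Measure.restrict_eq_self_of_ae_mem (mem_ae_iff.2 (measure_mono_null (hcompl _ hW) hρ))
  rw [← hself subset_union_left hVν, ← hself subset_union_right hVν']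
  exact Measure.restrict_iUnion_congr.2 fun q ↦ h'.restrict_largeAt_eq h hν _

/-! ### Drift and covariance functions -/

lemma IsTripletSystem.existsUnique_drift (hX : ∀ u, Measurable (X u))
    (hT : IsTripletSystem X P γ B νfd) : ∃! Γ : U → ℝ, ∀ s : Finset U, γ s = proj s Γ := by
  refine ⟨fun u ↦ γ {u} ⟨u, Finset.mem_singleton_self u⟩, fun s ↦ ?_, fun Γ hΓ ↦ ?_⟩
  · ext v
    change _ = γ {v.1} ⟨v.1, _⟩
    rw [(hT.consistent hX (Finset.singleton_subset_iff.2 v.2)).1]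
    rfl
  · funext u
    rw [hΓ {u}]
    rfl

lemma IsTripletSystem.existsUnique_covariance (hX : ∀ u, Measurable (X u))
    (hT : IsTripletSystem X P γ B νfd) :
    ∃! C : U → U → ℝ, ∀ s : Finset U, B s = Matrix.of fun u v : s ↦ C u v := by
  classical
  refine ⟨fun u v ↦ B {u, v} ⟨u, by simp⟩ ⟨v, by simp⟩, fun s ↦ ?_, fun C hC ↦ ?_⟩
  · ext u v
    have hsub : {u.1, v.1} ⊆ s := by simp [Finset.insert_subset_iff]
    change _ = B {u.1, v.1} ⟨u.1, _⟩ ⟨v.1, _⟩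
    rw [(hT.consistent hX hsub).2.1]
    rfl
  · funext u v
    rw [hC {u, v}]
    rfl

end System

end IDField

end

theorem mainTheorem8 {U Ω : Type*} [Nonempty U] [MeasurableSpace Ω]
    (P : Measure Ω) [IsProbabilityMeasure P]
    (X : U → Ω → ℝ) (hX : ∀ u, Measurable (X u))
    (hID : IDField.IsInfinitelyDivisible X P)
    (γ : ∀ s : Finset U, EuclideanSpace ℝ s)
    (B : ∀ s : Finset U, Matrix s s ℝ)
    (νfd : ∀ s : Finset U, Measure (EuclideanSpace ℝ s))
    (hT : IDField.IsTripletSystem X P γ B νfd) :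
    (∃! Γ : U → ℝ, ∀ s : Finset U, γ s = IDField.proj s Γ) ∧
    (∃! C : U → U → ℝ, ∀ s : Finset U, B s = Matrix.of fun u v : s => C u v) ∧
    (∃ ν : Measure (U → ℝ), IDField.ProjectsOnto ν νfd ∧
      ∀ u : U, ∫⁻ x, ENNReal.ofReal (min 1 (|x u| ^ 2)) ∂ν < ⊤) ∧
    (∀ ν : Measure (U → ℝ), IDField.ProjectsOnto ν νfd → IDField.DoesNotChargeZero ν →
      ∀ ν' : Measure (U → ℝ), IDField.ProjectsOnto ν' νfd → IDField.DoesNotChargeZero ν' →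
        ν' = ν) := by
  have hν : ∀ s, IDField.IsLevyMeasure (νfd s) := fun s ↦ (hT s).isLevyMeasure
  obtain ⟨ν, hp⟩ := hT.exists_projectsOnto hX
  exact ⟨hT.existsUnique_drift hX, hT.existsUnique_covariance hX,
    ⟨ν, hp, hp.lintegral_min_lt_top hν⟩,
    fun _ h h0 _ h' h0' ↦ h.eq_of_doesNotChargeZero h' hν h0 h0'⟩
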